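/- Let $\Sigma$ be a finitary algebraic signature, $\mathbf K$ a quasivariety of $\Sigma$-algebras (a class axiomatized by quasi-identities), $\tau$ a finite set of equations $\delta(x)\approx\epsilon(x)$ in at most one variable, and $X$ a countably infinite set of variables. For a $\Sigma$-algebra $A$ let $Co_{\mathbf K}(A)$ be the lattice, ordered by inclusion, of the congruences $\theta$ of $A$ with $A/\theta\in\mathbf K$, and let $$i_A\colon Co_{\mathbf K}(A)\to\wp(A),\qquad i_A(\theta)=\{a\in A\mid \langle\delta^A(a),\epsilon^A(a)\rangle\in\theta\text{ for all }\delta\approx\epsilon\text{ in }\tau\}.$$ The pair $(Co_{\mathbf K},i)$ is the equational filter pair given by $\tau$. Let $\Xi_A\colon\wp(A)\to Co_{\mathbf K}(A)$ be the left adjoint of $i_A$, so that $\Xi_A(S)=\bigwedge\{\theta\in Co_{\mathbf K}(A)\mid S\subseteq i_A(\theta)\}$. For $F\subseteq A$ let $\Omega_A(F)$ (Leibniz operator) be the greatest congruence $\theta$ of $A$ compatible with $F$, i.e. such that $a\in F$ and $\langle a,b\rangle\in\theta$ imply $b\in F$. Let $Fm(X)$ be the absolutely free $\Sigma$-algebra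 on $X$. The logic $l$ presented by $(Co_{\mathbf K},i)$ is the consequence relation on $Fm(X)$ given by $\Gamma\vdash\varphi$ iff for all $\theta\in Co_{\mathbf K}(Fm(X))$, $\Gamma\subseteq i_{Fm(X)}(\theta)$ implies $\varphi\in i_{Fm(X)}(\theta)$. Its theories are the $\vdash$-closed subsets of $Fm(X)$. An $l$-filter on $A$ is a set $F\subseteq A$ such that $\Gamma\vdash\varphi$ and $v[\Gamma]\subseteq F$ imply $v(\varphi)\in F$ for every homomorphism $v\colon Fm(X)\to A$. For a class $\mathbf K'$ of $\Sigma$-algebras write $\Gamma\models_{\mathbf K'}\varphi\approx\psi$ if every homomorphism from $Fm(X)$ to a member of $\mathbf K'$ that equalizes all equations in $\Gamma$ equalizes $\varphi\approx\psi$. The logic $l$ is algebraizable with equivalent algebraic semantics $\mathbf K'$ if there are a finite set $\tau'$ of equations in one variable and a finite set $\Delta(p,q)$ of formulas in two variables such that, for all formulas and all sets $\Gamma$ of formulas or of equations respectively: $\Gamma\vdash\varphi$ iff $\tau'(\Gamma)\models_{\mathbf K'}\tau'(\varphi)$; $\Gamma\models_{\mathbf K'}\varphi\approx\psi$ iff $\{\Delta(\xi,\eta)\mid\xi\approx\eta\in\Gamma\}\vdash\Delta(\varphi,\psi)$;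 and $\psi\dashv\vdash\Delta(\tau'(\psi))$. It is algebraizable if it is so with some class $\mathbf K'$. **Theorem.** For every $\Sigma$-algebra $A$ and every $\theta\in Co_{\mathbf K}(A)$, $$\Xi_A(i_A(\theta))\subseteq\theta\subseteq\Omega_A(i_A(\theta)).$$ Moreover, the following are equivalent: (a) one of the two inclusions is an equality for every $\theta\in Co_{\mathbf K}(Fm(X))$; that is, either $\Xi_{Fm(X)}(i_{Fm(X)}(\theta))=\theta$ for all such $\theta$, or $\theta=\Omega_{Fm(X)}(i_{Fm(X)}(\theta))$ for all such $\theta$; (b) both inclusions are equalities for all $\Sigma$-algebras $A$ and all $\theta\in Co_{\mathbf K}(A)$; (c) for every $\Sigma$-algebra $A$ and every $l$-filter $F$ on $A$, $\Xi_A(F)=\Omega_A(F)$; (d) $\Xi_{Fm(X)}(T)=\Omega_{Fm(X)}(T)$ for every theory $T$ of $l$; (e) $l$ is algebraizable, and $i_{Fm(X)}$ is an isomorphism from $Co_{\mathbf K}(Fm(X))$ onto the lattice of theories of $l$ which commutes with inverse images under substitutions (endomorphisms of $Fm(X)$); (e') as (e), with $l$ algebraizable with equivalent algebraic semantics $\mathbf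 K$ itself. -/

import Mathlib

open FirstOrder CategoryTheory

universe u v

namespace AlgLogic

/-! ### Algebras, absolutely free algebras, congruences

A signature is a first-order language `L` without relation symbols, a `Σ`-structure is a type `A`
with `[L.Structure A]`, homomorphisms are `A →[L] B`. The formula algebra over `X` is `L.Term X`. -/

section Algebra

set_option linter.unusedSectionVars false

variable {L : FirstOrder.Language.{u, v}} [L.IsAlgebraic]

/-- The absolutely free algebra structure on the set of formulas (terms) with variables in `X`. -/
instance termStructure (X : Type*) : L.Structure (L.Term X) where
  funMap f ts := FirstOrder.Language.Term.func f ts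
  RelMap r _ := isEmptyElim r

/-- Homomorphisms commute with evaluation of terms. -/
theorem hom_realize {A B X : Type*} [L.Structure A] [L.Structure B] (h : A →[L] B)
    (t : L.Term X) (w : X → A) : h (t.realize w) = t.realize (fun x => h (w x)) := by
  induction t with
  | var x => rfl
  | func f ts ih =>
    simp only [FirstOrder.Language.Term.realize_func, FirstOrder.Language.Hom.map_fun]
    congr 1
    funext i
    exact ih i

variable (L) in
/-- A congruence of an `L`-algebra: an equivalence relation compatible with all operations. -/
structure Congruence (A : Type*) [L.Structure A] extends Setoid A where
  map_fun' : ∀ {n : ℕ} (f : L.Functions n) (x y : Fin n → A), (∀ i, r (x i) (y i)) →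
    r (FirstOrder.Language.Structure.funMap f x) (FirstOrder.Language.Structure.funMap f y)

namespace Congruence

theorem ext' {A : Type*} [L.Structure A] {θ ρ : Congruence L A}
    (h : ∀ a b, θ.r a b ↔ ρ.r a b) : θ = ρ := by
  obtain ⟨s, hs⟩ := θ
  obtain ⟨t, ht⟩ := ρ
  obtain rfl : s = t := Setoid.ext h
  rfl

/-- Congruences are ordered by inclusion. -/
instance (A : Type*) [L.Structure A] : PartialOrder (Congruence L A) where
  le θ ρ := ∀ a b, θ.r a b → ρ.r a b
  le_refl _ _ _ h := h
  le_trans _ _ _ h k a b hab := k a b (h a b hab)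
  le_antisymm _ _ h k := ext' fun a b => ⟨h a b, k a b⟩

instance prestructure {A : Type*} [inst : L.Structure A] (θ : Congruence L A) :
    L.Prestructure θ.toSetoid where
  toStructure := inst
  fun_equiv {_ f} x y h := θ.map_fun' f x y h
  rel_equiv {_ r} _ _ _ := isEmptyElim r

/-- The quotient algebra `A/θ` (carrying Mathlib's quotient structure). -/
abbrev quot {A : Type u} [L.Structure A] (θ : Congruence L A) : Bundled.{u} L.Structure :=
  Bundled.of (Quotient θ.toSetoid)

/-- Congruences are preserved by all term operations. -/
theorem realize_rel {A X : Type*} [L.Structure A] (θ : Congruence L A) (t : L.Term X)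
    (w w' : X → A) (h : ∀ x, θ.r (w x) (w' x)) : θ.r (t.realize w) (t.realize w') := by
  induction t with
  | var x => exact h x
  | func f ts ih => exact θ.map_fun' f _ _ ih

/-- The inverse image `(f × f)⁻¹ θ` of a congruence under a homomorphism. -/
def comap {A B : Type*} [L.Structure A] [L.Structure B] (f : A →[L] B) (θ : Congruence L B) :
    Congruence L A where
  r a b := θ.r (f a) (f b)
  iseqv := ⟨fun _ => θ.iseqv.refl _, fun h => θ.iseqv.symm h, fun h k => θ.iseqv.trans h k⟩
  map_fun' g x y h := by
    rw [FirstOrder.Language.Hom.map_fun, FirstOrder.Language.Hom.map_fun]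
    exact θ.map_fun' g _ _ h

/-- The intersection of a set of congruences (the full relation if the set is empty). -/
def inter {A : Type*} [L.Structure A] (S : Set (Congruence L A)) : Congruence L A where
  r a b := ∀ θ ∈ S, θ.r a b
  iseqv := ⟨fun _ θ _ => θ.iseqv.refl _, fun h θ hθ => θ.iseqv.symm (h θ hθ),
    fun h k θ hθ => θ.iseqv.trans (h θ hθ) (k θ hθ)⟩
  map_fun' g x y h θ hθ := θ.map_fun' g x y fun i => h i θ hθ

/-- Finitely many instances of a nonempty directed family lie in one member of the family. -/
theorem exists_common {A ι : Type*} [L.Structure A] {S : Set (Congruence L A)}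
    (hS : S.Nonempty) (hd : DirectedOn (· ≤ ·) S) (s : Finset ι) (p q : ι → A)
    (h : ∀ i ∈ s, ∃ θ ∈ S, θ.r (p i) (q i)) : ∃ θ ∈ S, ∀ i ∈ s, θ.r (p i) (q i) := by
  classical
  induction s using Finset.induction_on with
  | empty =>
    obtain ⟨θ, hθ⟩ := hS
    exact ⟨θ, hθ, by simp⟩
  | insert j s _ ih =>
    obtain ⟨θ, hθ, h1⟩ := ih fun i hi => h i (Finset.mem_insert_of_mem hi)
    obtain ⟨ρ, hρ, h2⟩ := h j (Finset.mem_insert_self _ _)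
    obtain ⟨κ, hκ, h3, h4⟩ := hd θ hθ ρ hρ
    refine ⟨κ, hκ, fun i hi => ?_⟩
    rcases Finset.mem_insert.1 hi with rfl | hi
    · exact h4 _ _ h2
    · exact h3 _ _ (h1 i hi)

/-- The union of a nonempty directed set of congruences. -/
def directedUnion {A : Type*} [L.Structure A] (S : Set (Congruence L A))
    (hS : S.Nonempty) (hd : DirectedOn (· ≤ ·) S) : Congruence L A where
  r a b := ∃ θ ∈ S, θ.r a b
  iseqv := by
    refine ⟨fun a => ?_, ?_, ?_⟩
    · obtain ⟨θ, hθ⟩ := hS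
      exact ⟨θ, hθ, θ.iseqv.refl a⟩
    · rintro a b ⟨θ, hθ, h⟩
      exact ⟨θ, hθ, θ.iseqv.symm h⟩
    · rintro a b c ⟨θ, hθ, h⟩ ⟨ρ, hρ, k⟩
      obtain ⟨κ, hκ, h3, h4⟩ := hd θ hθ ρ hρ
      exact ⟨κ, hκ, κ.iseqv.trans (h3 _ _ h) (h4 _ _ k)⟩
  map_fun' g x y h := by
    obtain ⟨θ, hθ, h1⟩ := exists_common hS hd Finset.univ x y fun i _ => h i
    exact ⟨θ, hθ, θ.map_fun' g x y fun i => h1 i (Finset.mem_univ i)⟩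

end Congruence

/-! ### The Leibniz operator -/

/-- `θ` is compatible with `F`: if `a ∈ F` and `⟨a, b⟩ ∈ θ` then `b ∈ F`. -/
def Compatible {A : Type*} [L.Structure A] (θ : Congruence L A) (F : Set A) : Prop :=
  ∀ a b, a ∈ F → θ.r a b → b ∈ F

variable (L) in
/-- `a` and `b` are not separated by `F` through any unary polynomial operation. -/
def Indiscernible {A : Type*} [L.Structure A] (F : Set A) (a b : A) : Prop :=
  ∀ t : L.Term (Unit ⊕ A),
    t.realize (Sum.elim (fun _ => a) id) ∈ F ↔ t.realize (Sum.elim (fun _ => b) id) ∈ F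

theorem Compatible.indiscernible {A : Type*} [L.Structure A] {θ : Congruence L A} {F : Set A}
    (h : Compatible θ F) {a b : A} (hab : θ.r a b) : Indiscernible L F a b := by
  intro t
  have key : θ.r (t.realize (Sum.elim (fun _ => a) id)) (t.realize (Sum.elim (fun _ => b) id)) := by
    refine θ.realize_rel t _ _ ?_
    rintro (x | x)
    · exact hab
    · exact θ.iseqv.refl _
  exact ⟨fun hF => h _ _ hF key, fun hF => h _ _ hF (θ.iseqv.symm key)⟩

theorem Indiscernible.funMap {A : Type*} [L.Structure A] {F : Set A} {n : ℕ} (f : L.Functions n)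
    (x y : Fin n → A) (h : ∀ i, Indiscernible L F (x i) (y i)) :
    Indiscernible L F (FirstOrder.Language.Structure.funMap f x)
      (FirstOrder.Language.Structure.funMap f y) := by
  classical
  have main : ∀ s : Finset (Fin n), Indiscernible L F (FirstOrder.Language.Structure.funMap f x)
      (FirstOrder.Language.Structure.funMap f fun i => if i ∈ s then y i else x i) := by
    intro s
    induction s using Finset.induction_on with
    | empty => intro t; simp
    | insert j s hj ih =>
      intro t
      refine (ih t).trans ?_
      let z : Fin n → A := fun i => if i ∈ s then y i else x i
      let tj : L.Term (Unit ⊕ A) := FirstOrder.Language.Term.func f fun i =>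
        if i = j then FirstOrder.Language.Term.var (Sum.inl ())
        else FirstOrder.Language.Term.var (Sum.inr (z i))
      have hrel : ∀ c : A, tj.realize (Sum.elim (fun _ => c) id) =
          FirstOrder.Language.Structure.funMap f (fun i => if i = j then c else z i) := by
        intro c
        simp only [tj, FirstOrder.Language.Term.realize_func]
        congr 1
        funext i
        split_ifs <;> simp
      have hsub : ∀ c : A, (t.subst (Sum.elim (fun _ => tj)
            fun a => FirstOrder.Language.Term.var (Sum.inr a))).realize
            (Sum.elim (fun _ => c) id) =
          t.realize (Sum.elim (fun _ => FirstOrder.Language.Structure.funMap f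
            (fun i => if i = j then c else z i)) id) := by
        intro c
        rw [FirstOrder.Language.Term.realize_subst]
        congr 1
        funext i
        rcases i with i | i
        · exact hrel c
        · rfl
      have hx : (fun i => if i = j then x j else z i) = z := by
        funext i
        by_cases hi : i = j
        · subst hi; simp [z, hj]
        · simp [hi]
      have hy : (fun i => if i = j then y j else z i) =
          fun i => if i ∈ insert j s then y i else x i := by
        funext i
        by_cases hi : i = j
        · subst hi; simp
        · simp [hi, z]
      have := h j (t.subst (Sum.elim (fun _ => tj)
        fun a => FirstOrder.Language.Term.var (Sum.inr a)))
      rw [hsub, hsub, hx, hy] at this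
      exact this
  simpa using main Finset.univ

/-- Being related by some compatible congruence is the same as being indiscernible. -/
theorem exists_compatible_iff {A : Type*} [L.Structure A] (F : Set A) (a b : A) :
    (∃ θ : Congruence L A, Compatible θ F ∧ θ.r a b) ↔ Indiscernible L F a b := by
  constructor
  · rintro ⟨θ, hθ, h⟩
    exact hθ.indiscernible h
  · intro h
    let ρ : Congruence L A :=
      { r := Indiscernible L F
        iseqv := ⟨fun _ _ => Iff.rfl, fun h t => (h t).symm, fun h k t => (h t).trans (k t)⟩
        map_fun' := fun f x y h => Indiscernible.funMap f x y h }
    refine ⟨ρ, ?_, h⟩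
    intro a b ha hab
    exact (hab (FirstOrder.Language.Term.var (Sum.inl ()))).1 ha

/-- The Leibniz operator: the greatest congruence compatible with `F`, given as the union of all
compatible congruences. -/
def leibniz {A : Type*} [L.Structure A] (F : Set A) : Congruence L A where
  r a b := ∃ θ : Congruence L A, Compatible θ F ∧ θ.r a b
  iseqv := by
    simp only [exists_compatible_iff]
    exact ⟨fun _ _ => Iff.rfl, fun h t => (h t).symm, fun h k t => (h t).trans (k t)⟩
  map_fun' f x y h := by
    simp only [exists_compatible_iff] at h ⊢
    exact Indiscernible.funMap f x y h

theorem leibniz_isGreatest {A : Type*} [L.Structure A] (F : Set A) :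
    IsGreatest {θ : Congruence L A | Compatible θ F} (leibniz F) := by
  refine ⟨?_, fun θ hθ a b h => ⟨θ, hθ, h⟩⟩
  rintro a b ha ⟨θ, hθ, h⟩
  exact hθ a b ha h

/-! ### Quasivarieties and relative congruences -/

variable (L) in
/-- A quasi-identity `p₁ ≈ q₁ ∧ … ∧ pₙ ≈ qₙ → p ≈ q` in the variables `x₀, x₁, …`. -/
structure QuasiIdentity where
  premises : Finset (L.Term ℕ × L.Term ℕ)
  conclusion : L.Term ℕ × L.Term ℕ

/-- Validity of a quasi-identity in an algebra. -/
def QuasiIdentity.Holds (q : QuasiIdentity L) (A : Type*) [L.Structure A] : Prop :=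
  ∀ w : ℕ → A, (∀ e ∈ q.premises, e.1.realize w = e.2.realize w) →
    q.conclusion.1.realize w = q.conclusion.2.realize w

/-- A quasivariety is a class of algebras axiomatizable by quasi-identities. -/
def IsQuasivariety (K : Set (Bundled.{u} L.Structure)) : Prop :=
  ∃ Q : Set (QuasiIdentity L), ∀ A : Bundled.{u} L.Structure, A ∈ K ↔ ∀ q ∈ Q, q.Holds A

/-- `Co_K(A)`: the congruences `θ` of `A` with `A/θ ∈ K`, ordered by inclusion. -/
abbrev RelCongruence (K : Set (Bundled.{u} L.Structure)) (A : Type u) [L.Structure A] : Type u :=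
  {θ : Congruence L A // θ.quot ∈ K}

theorem QuasiIdentity.holds_quot {A : Type u} [L.Structure A] (q : QuasiIdentity L)
    (θ : Congruence L A) : q.Holds θ.quot ↔
      ∀ w : ℕ → A, (∀ e ∈ q.premises, θ.r (e.1.realize w) (e.2.realize w)) →
        θ.r (q.conclusion.1.realize w) (q.conclusion.2.realize w) := by
  have key : ∀ (w : ℕ → A) (s t : L.Term ℕ),
      ((s.realize fun i => (Quotient.mk θ.toSetoid (w i))) =
        t.realize fun i => (Quotient.mk θ.toSetoid (w i))) ↔ θ.r (s.realize w) (t.realize w) := by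
    intro w s t
    rw [FirstOrder.Language.Term.realize_quotient_mk',
      FirstOrder.Language.Term.realize_quotient_mk']
    exact Quotient.eq
  constructor
  · intro h w hw
    exact (key w _ _).1 (h (fun i => Quotient.mk θ.toSetoid (w i))
      fun e he => (key w _ _).2 (hw e he))
  · intro h w hw
    obtain ⟨w', rfl⟩ : ∃ w' : ℕ → A, w = fun i => Quotient.mk θ.toSetoid (w' i) :=
      ⟨fun i => (w i).out, funext fun i => (Quotient.out_eq _).symm⟩
    exact (key w' _ _).2 (h w' fun e he => (key w' _ _).1 (hw e he))

variable {K : Set (Bundled.{u} L.Structure)}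

theorem IsQuasivariety.inter_mem (hK : IsQuasivariety K) {A : Type u} [L.Structure A]
    (S : Set (RelCongruence K A)) : (Congruence.inter (Subtype.val '' S)).quot ∈ K := by
  obtain ⟨Q, hQ⟩ := hK
  refine (hQ _).2 fun q hq => (q.holds_quot _).2 ?_
  rintro w hw _ ⟨θ, hθ, rfl⟩
  exact (q.holds_quot _).1 ((hQ _).1 θ.2 q hq) w fun e he => hw e he _ ⟨θ, hθ, rfl⟩

theorem IsQuasivariety.directedUnion_mem (hK : IsQuasivariety K) {A : Type u} [L.Structure A]
    (S : Set (Congruence L A)) (hS : S.Nonempty) (hd : DirectedOn (· ≤ ·) S)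
    (hSK : ∀ θ ∈ S, θ.quot ∈ K) : (Congruence.directedUnion S hS hd).quot ∈ K := by
  obtain ⟨Q, hQ⟩ := hK
  refine (hQ _).2 fun q hq => (q.holds_quot _).2 ?_
  intro w hw
  obtain ⟨θ, hθ, h⟩ := Congruence.exists_common hS hd q.premises (fun e => e.1.realize w)
    (fun e => e.2.realize w) hw
  exact ⟨θ, hθ, (q.holds_quot _).1 ((hQ _).1 (hSK θ hθ) q hq) w h⟩

theorem IsQuasivariety.comap_mem (hK : IsQuasivariety K) {A B : Type u} [L.Structure A]
    [L.Structure B] (f : A →[L] B) (θ : RelCongruence K B) :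
    (Congruence.comap f θ.1).quot ∈ K := by
  obtain ⟨Q, hQ⟩ := hK
  refine (hQ _).2 fun q hq => (q.holds_quot _).2 ?_
  intro w hw
  have := (q.holds_quot _).1 ((hQ _).1 θ.2 q hq) (fun i => f (w i))
  simp only [← hom_realize] at this
  exact this hw

/-- `Co_K(A)` is a complete lattice; infima are intersections. -/
@[reducible]
def relCongruenceLattice (hK : IsQuasivariety K) (A : Type u) [L.Structure A] :
    CompleteLattice (RelCongruence K A) :=
  @completeLatticeOfInf (RelCongruence K A) inferInstance
    ⟨fun S => ⟨Congruence.inter (Subtype.val '' S), hK.inter_mem S⟩⟩ (by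
      intro S
      refine ⟨fun θ hθ a b h => h _ ⟨θ, hθ, rfl⟩, fun ρ hρ a b h => ?_⟩
      rintro _ ⟨θ, hθ, rfl⟩
      exact hρ hθ a b h)

theorem relCongruence_sInf (hK : IsQuasivariety K) {A : Type u} [L.Structure A]
    (S : Set (RelCongruence K A)) (a b : A) :
    ((relCongruenceLattice hK A).sInf S).1.r a b ↔ ∀ θ ∈ S, θ.1.r a b := by
  constructor
  · intro h θ hθ
    exact h _ ⟨θ, hθ, rfl⟩
  · rintro h _ ⟨θ, hθ, rfl⟩
    exact h θ hθ

/-- Directed suprema in `Co_K(A)` are unions. -/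
theorem relCongruence_sSup (hK : IsQuasivariety K) {A : Type u} [L.Structure A]
    (S : Set (RelCongruence K A)) (hS : S.Nonempty) (hd : DirectedOn (· ≤ ·) S) (a b : A) :
    ((relCongruenceLattice hK A).sSup S).1.r a b ↔ ∃ θ ∈ S, θ.1.r a b := by
  let _ := relCongruenceLattice hK A
  constructor
  · have hd' : DirectedOn (· ≤ ·) (Subtype.val '' S : Set (Congruence L A)) := by
      rintro _ ⟨θ, hθ, rfl⟩ _ ⟨ρ, hρ, rfl⟩
      obtain ⟨κ, hκ, h1, h2⟩ := hd θ hθ ρ hρ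
      exact ⟨κ.1, ⟨κ, hκ, rfl⟩, h1, h2⟩
    let U : RelCongruence K A := ⟨Congruence.directedUnion _ (hS.image _) hd',
      hK.directedUnion_mem _ _ _ (by rintro _ ⟨θ, _, rfl⟩; exact θ.2)⟩
    have hU : sSup S ≤ U := sSup_le fun θ hθ a b h => ⟨θ.1, ⟨θ, hθ, rfl⟩, h⟩
    intro h
    obtain ⟨_, ⟨θ, hθ, rfl⟩, h'⟩ := hU a b h
    exact ⟨θ, hθ, h'⟩
  · rintro ⟨θ, hθ, h⟩
    exact (le_sSup hθ : θ ≤ sSup S) a b h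

theorem relCongruence_compactlyGenerated (hK : IsQuasivariety K) (A : Type u) [L.Structure A] :
    @IsCompactlyGenerated (RelCongruence K A) (relCongruenceLattice hK A) := by
  let _ := relCongruenceLattice hK A
  let g : A × A → RelCongruence K A := fun p => sInf {θ | θ.1.r p.1 p.2}
  have hg : ∀ p, (g p).1.r p.1 p.2 := fun p => (relCongruence_sInf hK _ _ _).2 fun θ hθ => hθ
  have hg' : ∀ p (θ : RelCongruence K A), θ.1.r p.1 p.2 → g p ≤ θ := fun p θ h => sInf_le h
  refine ⟨fun θ => ⟨g '' {p | θ.1.r p.1 p.2}, ?_, ?_⟩⟩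
  · rintro _ ⟨p, -, rfl⟩
    rw [CompleteLattice.isCompactElement_iff_le_of_directed_sSup_le]
    intro S hS hd h
    obtain ⟨ρ, hρ, h'⟩ := (relCongruence_sSup hK S hS hd _ _).1 (h _ _ (hg p))
    exact ⟨ρ, hρ, hg' p ρ h'⟩
  · apply le_antisymm
    · refine sSup_le ?_
      rintro _ ⟨p, hp, rfl⟩
      exact hg' p θ hp
    · intro a b h
      have h1 : g (a, b) ≤ sSup (g '' {p | θ.1.r p.1 p.2}) := le_sSup ⟨(a, b), h, rfl⟩
      exact h1 a b (hg (a, b))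

/-! ### Consequence relations, theories, filters, algebraizability -/

variable (L) in
/-- A (finitary, structural) Tarskian consequence relation on an algebra `A`. A logic is a
consequence relation on a formula algebra `L.Term X`. -/
structure ConsequenceRelation (A : Type*) [L.Structure A] where
  entails : Set A → A → Prop
  refl : ∀ Γ φ, φ ∈ Γ → entails Γ φ
  cut : ∀ Γ Δ φ, entails Γ φ → (∀ ψ ∈ Γ, entails Δ ψ) → entails Δ φ
  mono : ∀ Γ Δ φ, Γ ⊆ Δ → entails Γ φ → entails Δ φ
  finitary : ∀ Γ φ, entails Γ φ → ∃ Δ ⊆ Γ, Δ.Finite ∧ entails Δ φ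
  structural : ∀ Γ φ (σ : A →[L] A), entails Γ φ → entails (σ '' Γ) (σ φ)

/-- The theories of a consequence relation: the sets closed under consequence. -/
def ConsequenceRelation.IsTheory {A : Type*} [L.Structure A] (l : ConsequenceRelation L A)
    (T : Set A) : Prop :=
  ∀ φ, l.entails T φ → φ ∈ T

/-- The filters of a logic on an arbitrary algebra. -/
def ConsequenceRelation.IsFilter {X : Type*} (l : ConsequenceRelation L (L.Term X))
    {A : Type*} [L.Structure A] (F : Set A) : Prop :=
  ∀ Γ φ, l.entails Γ φ → ∀ w : L.Term X →[L] A, w '' Γ ⊆ F → w φ ∈ F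

/-- Equational consequence `Γ ⊨_K φ ≈ ψ` over the formula algebra with variables `X`. -/
def EqEntails (K : Set (Bundled.{u} L.Structure)) {X : Type*}
    (Γ : Set (L.Term X × L.Term X)) (e : L.Term X × L.Term X) : Prop :=
  ∀ A ∈ K, ∀ h : L.Term X →[L] A, (∀ p ∈ Γ, h p.1 = h p.2) → h e.1 = h e.2

/-- The equations `δ(a) ≈ ε(a)`, for `δ(x) ≈ ε(x)` in `τ` and `a ∈ S`, as pairs of elements. -/
def applyEqs {A : Type*} [L.Structure A] (τ : Set (L.Term Unit × L.Term Unit)) (S : Set A) :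
    Set (A × A) :=
  {p | ∃ e ∈ τ, ∃ a ∈ S, p = (e.1.realize fun _ => a, e.2.realize fun _ => a)}

/-- The formulas `Δ(φ, ψ)`, for `φ ≈ ψ` in `Γ`. -/
def applyForms {X : Type*} (D : Set (L.Term (Fin 2))) (Γ : Set (L.Term X × L.Term X)) :
    Set (L.Term X) :=
  {χ | ∃ d ∈ D, ∃ p ∈ Γ, χ = d.realize ![p.1, p.2]}

/-- `l` has an algebraic semantics in `K` given by the equations `τ`. -/
def HasAlgebraicSemantics {X : Type*} (l : ConsequenceRelation L (L.Term X))
    (K : Set (Bundled.{u} L.Structure)) (τ : Set (L.Term Unit × L.Term Unit)) : Prop :=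
  ∀ Γ φ, l.entails Γ φ ↔ ∀ e ∈ applyEqs τ {φ}, EqEntails K (applyEqs τ Γ) e

/-- `l` is algebraizable (in the sense of Blok and Pigozzi) with equivalent algebraic
semantics `K`. -/
def AlgebraizableWith {X : Type*} (l : ConsequenceRelation L (L.Term X))
    (K : Set (Bundled.{u} L.Structure)) : Prop :=
  ∃ (τ : Finset (L.Term Unit × L.Term Unit)) (D : Finset (L.Term (Fin 2))),
    HasAlgebraicSemantics l K (τ : Set (L.Term Unit × L.Term Unit)) ∧
    (∀ Γ e, EqEntails K Γ e ↔ ∀ χ ∈ applyForms (D : Set (L.Term (Fin 2))) {e}, l.entails (applyForms (D : Set (L.Term (Fin 2))) Γ) χ) ∧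
    (∀ ψ, (∀ χ ∈ applyForms (D : Set (L.Term (Fin 2))) (applyEqs (τ : Set (L.Term Unit × L.Term Unit)) {ψ}), l.entails {ψ} χ) ∧
      l.entails (applyForms (D : Set (L.Term (Fin 2))) (applyEqs (τ : Set (L.Term Unit × L.Term Unit)) {ψ})) ψ)

/-- `l` is algebraizable: it has some equivalent algebraic semantics. -/
def Algebraizable {X : Type*} (l : ConsequenceRelation L (L.Term X)) : Prop :=
  ∃ K : Set (Bundled.{u} L.Structure), AlgebraizableWith l K

end Algebra

/-! ### Filter pairs -/

/-- A filter pair: a contravariant functor `G` from `L`-algebras to algebraic lattices (with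
maps preserving arbitrary infima and directed suprema) and a natural transformation `i` from `G`
to the power set functor, each component preserving arbitrary infima and directed suprema. -/
structure FilterPair (L : FirstOrder.Language.{u, v}) where
  G : ∀ (A : Type u) [L.Structure A], Type u
  [lattice : ∀ (A : Type u) [L.Structure A], CompleteLattice (G A)]
  algebraic : ∀ (A : Type u) [L.Structure A], IsCompactlyGenerated (G A)
  map : ∀ {A B : Type u} [L.Structure A] [L.Structure B], (A →[L] B) → G B → G A
  map_id : ∀ {A : Type u} [L.Structure A] (z : G A), map (FirstOrder.Language.Hom.id L A) z = z
  map_comp : ∀ {A B C : Type u} [L.Structure A] [L.Structure B] [L.Structure C]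
    (g : B →[L] C) (f : A →[L] B) (z : G C), map (g.comp f) z = map f (map g z)
  map_sInf : ∀ {A B : Type u} [L.Structure A] [L.Structure B] (f : A →[L] B) (S : Set (G B)),
    map f (sInf S) = sInf (map f '' S)
  map_sSup : ∀ {A B : Type u} [L.Structure A] [L.Structure B] (f : A →[L] B) (S : Set (G B)),
    S.Nonempty → DirectedOn (· ≤ ·) S → map f (sSup S) = sSup (map f '' S)
  i : ∀ {A : Type u} [L.Structure A], G A → Set A
  i_sInf : ∀ {A : Type u} [L.Structure A] (S : Set (G A)), i (sInf S) = ⋂ z ∈ S, i z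
  i_sSup : ∀ {A : Type u} [L.Structure A] (S : Set (G A)),
    S.Nonempty → DirectedOn (· ≤ ·) S → i (sSup S) = ⋃ z ∈ S, i z
  natural : ∀ {A B : Type u} [L.Structure A] [L.Structure B] (f : A →[L] B) (z : G B),
    i (map f z) = f ⁻¹' i z

namespace FilterPair

variable {L : FirstOrder.Language.{u, v}} (P : FilterPair L)

instance (A : Type u) [L.Structure A] : CompleteLattice (P.G A) := P.lattice A

theorem i_mono {A : Type u} [L.Structure A] : Monotone (P.i (A := A)) := by
  intro y z h
  have h1 : sInf {y, z} = y := by rw [sInf_pair]; exact inf_eq_left.2 h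
  have h2 := P.i_sInf {y, z}
  rw [h1] at h2
  intro a ha
  rw [h2] at ha
  exact Set.mem_iInter₂.1 ha z (by simp)

/-- The left adjoint of `i`. -/
def Xi {A : Type u} [L.Structure A] (S : Set A) : P.G A := sInf {z | S ⊆ P.i z}

theorem gc {A : Type u} [L.Structure A] : GaloisConnection (P.Xi (A := A)) P.i := by
  intro S z
  constructor
  · intro h
    have h1 : S ⊆ P.i (P.Xi S) := by
      rw [Xi, P.i_sInf]
      exact Set.subset_iInter₂ fun z hz => hz
    exact h1.trans (P.i_mono h)
  · intro h
    exact sInf_le h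

theorem mem_i_Xi {A : Type u} [L.Structure A] (S : Set A) (a : A) :
    a ∈ P.i (P.Xi S) ↔ ∀ z, S ⊆ P.i z → a ∈ P.i z := by
  rw [Xi, P.i_sInf]
  simp

/-- The consequence relation on `A` presented by a filter pair: `Γ ⊢ φ` iff every set in the image
of `i` that contains `Γ` contains `φ`. For `A = L.Term X` this is the presented logic. -/
def logic (A : Type u) [L.Structure A] : ConsequenceRelation L A where
  entails Γ φ := ∀ z : P.G A, Γ ⊆ P.i z → φ ∈ P.i z
  refl _ _ h _ hz := hz h
  cut _ _ _ h k z hz := h z fun ψ hψ => k ψ hψ z hz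
  mono _ _ _ h k z hz := k z (h.trans hz)
  finitary Γ φ h := by
    classical
    let S : Set (P.G A) := {z | ∃ Δ : Set A, Δ ⊆ Γ ∧ Δ.Finite ∧ z = P.Xi Δ}
    have hS : S.Nonempty := ⟨P.Xi ∅, ∅, Set.empty_subset _, Set.finite_empty, rfl⟩
    have hd : DirectedOn (· ≤ ·) S := by
      rintro _ ⟨Δ, h1, h2, rfl⟩ _ ⟨Δ', h3, h4, rfl⟩
      exact ⟨P.Xi (Δ ∪ Δ'), ⟨_, Set.union_subset h1 h3, h2.union h4, rfl⟩,
        P.gc.monotone_l Set.subset_union_left, P.gc.monotone_l Set.subset_union_right⟩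
    have hΓ : Γ ⊆ P.i (sSup S) := by
      intro a ha
      have h1 : P.Xi {a} ≤ sSup S :=
        le_sSup ⟨{a}, Set.singleton_subset_iff.2 ha, Set.finite_singleton a, rfl⟩
      exact (P.gc _ _).1 h1 rfl
    have hφ := h _ hΓ
    rw [P.i_sSup S hS hd] at hφ
    obtain ⟨z, hz, hφ⟩ := Set.mem_iUnion₂.1 hφ
    obtain ⟨Δ, h1, h2, rfl⟩ := hz
    exact ⟨Δ, h1, h2, (P.mem_i_Xi Δ φ).1 hφ⟩
  structural Γ φ σ h z hz := by
    have h1 : Γ ⊆ P.i (P.map σ z) := by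
      rw [P.natural]
      exact Set.image_subset_iff.1 hz
    have h2 := h _ h1
    rw [P.natural] at h2
    exact h2

end FilterPair

/-! ### Equational filter pairs -/

section Equational

variable {L : FirstOrder.Language.{u, v}} [L.IsAlgebraic] {K : Set (Bundled.{u} L.Structure)}

/-- `i_A(θ) = {a ∈ A | ⟨δ(a), ε(a)⟩ ∈ θ for all δ ≈ ε in τ}`. -/
def eqI (τ : Finset (L.Term Unit × L.Term Unit)) {A : Type u} [L.Structure A]
    (θ : RelCongruence K A) : Set A :=
  {a | ∀ e ∈ τ, θ.1.r (e.1.realize fun _ => a) (e.2.realize fun _ => a)}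

/-- `Co_K(f) = (f × f)⁻¹`. -/
def relComap (hK : IsQuasivariety K) {A B : Type u} [L.Structure A] [L.Structure B]
    (f : A →[L] B) (θ : RelCongruence K B) : RelCongruence K A :=
  ⟨θ.1.comap f, hK.comap_mem f θ⟩

/-- The equational filter pair `(Co_K, i)` given by a quasivariety `K` and a finite set `τ` of
equations in one variable. -/
def equationalFilterPair (hK : IsQuasivariety K) (τ : Finset (L.Term Unit × L.Term Unit)) :
    FilterPair L where
  G A _ := RelCongruence K A
  lattice A _ := relCongruenceLattice hK A
  algebraic A _ := relCongruence_compactlyGenerated hK A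
  map f θ := relComap hK f θ
  map_id _ := rfl
  map_comp _ _ _ := rfl
  map_sInf f S := by
    refine Subtype.ext (Congruence.ext' fun a b => ?_)
    rw [relCongruence_sInf]
    refine (relCongruence_sInf hK S _ _).trans ?_
    simp only [Set.forall_mem_image]
    rfl
  map_sSup f S hS hd := by
    have hd' : DirectedOn (· ≤ ·) (relComap hK f '' S) := by
      rintro _ ⟨θ, hθ, rfl⟩ _ ⟨ρ, hρ, rfl⟩
      obtain ⟨κ, hκ, h1, h2⟩ := hd θ hθ ρ hρ
      exact ⟨_, ⟨κ, hκ, rfl⟩, fun a b h => h1 _ _ h, fun a b h => h2 _ _ h⟩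
    refine Subtype.ext (Congruence.ext' fun a b => ?_)
    rw [relCongruence_sSup hK _ (hS.image _) hd']
    refine (relCongruence_sSup hK S hS hd _ _).trans ?_
    simp only [Set.exists_mem_image]
    rfl
  i θ := eqI τ θ
  i_sInf S := by
    ext a
    simp only [eqI, relCongruence_sInf, Set.mem_ofPred_eq, Set.mem_iInter]
    exact ⟨fun h θ hθ e he => h e he θ hθ, fun h e he θ hθ => h θ hθ e he⟩
  i_sSup S hS hd := by
    ext a
    simp only [eqI, relCongruence_sSup hK S hS hd, Set.mem_ofPred_eq, Set.mem_iUnion]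
    constructor
    · intro h
      obtain ⟨_, ⟨θ, hθ, rfl⟩, h1⟩ := Congruence.exists_common
        (S := Subtype.val '' S) (hS.image _) (by
          rintro _ ⟨θ, hθ, rfl⟩ _ ⟨ρ, hρ, rfl⟩
          obtain ⟨κ, hκ, h1, h2⟩ := hd θ hθ ρ hρ
          exact ⟨κ.1, ⟨κ, hκ, rfl⟩, h1, h2⟩) τ
        (fun e => e.1.realize fun _ => a) (fun e => e.2.realize fun _ => a) (by
          intro e he
          obtain ⟨θ, hθ, h2⟩ := h e he
          exact ⟨θ.1, ⟨θ, hθ, rfl⟩, h2⟩)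
      exact ⟨θ, hθ, h1⟩
    · rintro ⟨θ, hθ, h⟩ e he
      exact ⟨θ, hθ, h e he⟩
  natural f θ := by
    ext a
    have h : ∀ t : L.Term Unit, f (t.realize fun _ => a) = t.realize fun _ => f a :=
      fun t => hom_realize f t _
    change (∀ e ∈ τ, θ.1.r (f (e.1.realize fun _ => a)) (f (e.2.realize fun _ => a))) ↔
      ∀ e ∈ τ, θ.1.r (e.1.realize fun _ => f a) (e.2.realize fun _ => f a)
    simp only [h]

/-- The left adjoint `Ξ_A` of `i_A` for an equational filter pair. -/
def eqXi (hK : IsQuasivariety K) (τ : Finset (L.Term Unit × L.Term Unit)) {A : Type u}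
    [L.Structure A] (S : Set A) : RelCongruence K A :=
  (equationalFilterPair hK τ).Xi S

theorem eqXi_le_iff (hK : IsQuasivariety K) (τ : Finset (L.Term Unit × L.Term Unit)) {A : Type u}
    [L.Structure A] (S : Set A) (θ : RelCongruence K A) : eqXi hK τ S ≤ θ ↔ S ⊆ eqI τ θ :=
  (equationalFilterPair hK τ).gc S θ

/-- The logic with variables `X` presented by an equational filter pair. -/
def eqLogic (hK : IsQuasivariety K) (τ : Finset (L.Term Unit × L.Term Unit)) (X : Type u) :
    ConsequenceRelation L (L.Term X) :=
  (equationalFilterPair hK τ).logic (L.Term X)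

/-- `i_{Fm(X)}`, as a map from `Co_K(Fm(X))` to the theories of the presented logic, is a lattice
isomorphism commuting with (inverse images under) substitutions. -/
def IsSubstitutionPreservingIso (hK : IsQuasivariety K)
    (τ : Finset (L.Term Unit × L.Term Unit)) (X : Type u) : Prop :=
  ∃ Φ : RelCongruence K (L.Term X) ≃o {T : Set (L.Term X) // (eqLogic hK τ X).IsTheory T},
    (∀ θ, (Φ θ : Set (L.Term X)) = eqI τ θ) ∧
    ∀ (σ : L.Term X →[L] L.Term X) (θ : RelCongruence K (L.Term X)),
      (Φ (relComap hK σ θ) : Set (L.Term X)) = σ ⁻¹' (Φ θ : Set (L.Term X))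

end Equational

end AlgLogic

/-!
The heart of the argument is that, if `i` is injective on `Co_K(Fm(X))`, then membership in relative
congruences can be tested by `i` through finitely many formulas in two variables: there is a finite
set `D(p, q)` such that `D(a, b) ⊆ i_A(θ)` if and only if `⟨a, b⟩ ∈ θ`, for *every* algebra `A` and
every `θ ∈ Co_K(A)` (`exists_isEquivalenceSystem`). To find `D`, take two variables `x ≠ y` and the
least `θ₀ ∈ Co_K(Fm(X))` containing `⟨x, y⟩`. Since `Ξ(i(θ₀)) = θ₀` and `i` preserves directed
suprema, already `Ξ(D₀)` contains `⟨x, y⟩` for some finite `D₀ ⊆ i(θ₀)`. Identify all variables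
of `D₀` other than `y`; the naturality of `i` transports the statement from `⟨x, y⟩` to any `⟨a, b⟩`.

Once `D` is available, everything else is a translation between formulas and equations:

* `D(a, a) ⊆ i_A(θ)` and the compatibility of `Ω(i_A(θ))` with `i_A(θ)` give `Ω(i_A(θ)) ≤ θ`, and
  `θ ≤ Ξ(i_A(θ))` is clear, so both inclusions are equalities;
* every filter `F` of the logic is `i_A(θ)` for the relative congruence `θ` consisting of the pairs
  `⟨a, b⟩` with `D(a, b) ⊆ F` (`IsEquivalenceSystem.exists_eqI_eq`), because valid implications
  between equations turn into derivations which `F` respects;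
* `τ` and `D` witness that the logic is algebraizable with equivalent algebraic semantics `K`.

Conversely, each of the conditions makes `i` injective on `Co_K(Fm(X))`: this is so for the second
alternative of the first condition as well, because `θ` is then recovered from `i(θ)` as its Leibniz
congruence. Injectivity and `i ∘ Ξ ∘ i = i` give `Ξ(i(θ)) = θ`.
-/

namespace AlgLogic

variable {L : FirstOrder.Language.{u, v}} [L.IsAlgebraic]

/-! ### Evaluation homomorphisms and kernels -/

/-- The homomorphism from the formula algebra that extends an assignment of the variables. -/
def evalHom {X A : Type*} [L.Structure A] (w : X → A) : L.Term X →[L] A where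
  toFun t := t.realize w
  map_fun' _ _ := rfl
  map_rel' r _ := isEmptyElim r

@[simp]
theorem evalHom_apply {X A : Type*} [L.Structure A] (w : X → A) (t : L.Term X) :
    evalHom w t = t.realize w := rfl

/-- The kernel of a homomorphism. -/
def Congruence.ker {A B : Type*} [L.Structure A] [L.Structure B] (f : A →[L] B) :
    Congruence L A where
  r a b := f a = f b
  iseqv := ⟨fun _ => rfl, fun h => h.symm, fun h k => h.trans k⟩
  map_fun' g x y h := by
    rw [FirstOrder.Language.Hom.map_fun, FirstOrder.Language.Hom.map_fun]
    exact congrArg _ (funext h)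

/-- The canonical homomorphism onto the quotient algebra. -/
def Congruence.mkHom {A : Type u} [L.Structure A] (θ : Congruence L A) : A →[L] θ.quot where
  toFun a := Quotient.mk θ.toSetoid a
  map_fun' f x := (FirstOrder.Language.funMap_quotient_mk' θ.toSetoid f x).symm
  map_rel' r _ := isEmptyElim r

variable {K : Set (CategoryTheory.Bundled.{u} L.Structure)}

theorem IsQuasivariety.ker_mem (hK : IsQuasivariety K) {A : Type u} [L.Structure A]
    {B : CategoryTheory.Bundled.{u} L.Structure} (hB : B ∈ K) (f : A →[L] B) :
    (Congruence.ker f).quot ∈ K := by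
  obtain ⟨Q, hQ⟩ := hK
  refine (hQ _).2 fun q hq => (q.holds_quot _).2 fun w hw => ?_
  have h := (hQ B).1 hB q hq (fun n => f (w n))
  simp only [← hom_realize] at h
  exact h hw

/-- Equational consequence relative to `K` is membership in the generated relative congruence. -/
theorem eqEntails_iff (hK : IsQuasivariety K) {X : Type u} (Γ : Set (L.Term X × L.Term X))
    (e : L.Term X × L.Term X) : EqEntails K Γ e ↔
      ∀ θ : RelCongruence K (L.Term X), (∀ p ∈ Γ, θ.1.r p.1 p.2) → θ.1.r e.1 e.2 := by
  constructor
  · intro h θ hθ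
    exact Quotient.exact (h _ θ.2 θ.1.mkHom fun p hp => Quotient.sound (hθ p hp))
  · intro h B hB f hf
    exact h ⟨Congruence.ker f, hK.ker_mem hB f⟩ hf

/-! ### The maps `i` and `Ξ` -/

theorem eqLogic_entails (hK : IsQuasivariety K) (τ : Finset (L.Term Unit × L.Term Unit))
    {X : Type u} (Γ : Set (L.Term X)) (φ : L.Term X) :
    (eqLogic hK τ X).entails Γ φ ↔
      ∀ θ : RelCongruence K (L.Term X), Γ ⊆ eqI τ θ → φ ∈ eqI τ θ := Iff.rfl

theorem eqI_relComap (hK : IsQuasivariety K) (τ : Finset (L.Term Unit × L.Term Unit))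
    {A B : Type u} [L.Structure A] [L.Structure B] (f : A →[L] B) (θ : RelCongruence K B) :
    eqI τ (relComap hK f θ) = f ⁻¹' eqI τ θ :=
  (equationalFilterPair hK τ).natural f θ

theorem eqI_mono {τ : Finset (L.Term Unit × L.Term Unit)} {A : Type u} [L.Structure A]
    {θ ρ : RelCongruence K A} (h : θ ≤ ρ) : eqI τ θ ⊆ eqI τ ρ :=
  fun _ ha e he => h _ _ (ha e he)

theorem compatible_eqI (τ : Finset (L.Term Unit × L.Term Unit)) {A : Type u} [L.Structure A]
    (θ : RelCongruence K A) : Compatible θ.1 (eqI τ θ) := by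
  intro a b ha hab e he
  have key : ∀ t : L.Term Unit, θ.1.r (t.realize fun _ => a) (t.realize fun _ => b) :=
    fun t => θ.1.realize_rel t _ _ fun _ => hab
  exact θ.1.iseqv.trans (θ.1.iseqv.symm (key e.1)) (θ.1.iseqv.trans (ha e he) (key e.2))

theorem le_leibniz_eqI (τ : Finset (L.Term Unit × L.Term Unit)) {A : Type u} [L.Structure A]
    (θ : RelCongruence K A) : θ.1 ≤ leibniz (eqI τ θ) :=
  (leibniz_isGreatest _).2 (compatible_eqI τ θ)

theorem eqXi_eqI_le (hK : IsQuasivariety K) (τ : Finset (L.Term Unit × L.Term Unit)) {A : Type u}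
    [L.Structure A] (θ : RelCongruence K A) : eqXi hK τ (eqI τ θ) ≤ θ :=
  (eqXi_le_iff hK τ _ θ).2 subset_rfl

theorem subset_eqI_eqXi (hK : IsQuasivariety K) (τ : Finset (L.Term Unit × L.Term Unit))
    {A : Type u} [L.Structure A] (S : Set A) : S ⊆ eqI τ (eqXi hK τ S) :=
  (eqXi_le_iff hK τ S _).1 le_rfl

theorem eqI_eqXi_eqI (hK : IsQuasivariety K) (τ : Finset (L.Term Unit × L.Term Unit)) {A : Type u}
    [L.Structure A] (θ : RelCongruence K A) : eqI τ (eqXi hK τ (eqI τ θ)) = eqI τ θ :=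
  (eqI_mono (eqXi_eqI_le hK τ θ)).antisymm (subset_eqI_eqXi hK τ _)

theorem eqXi_eqI_of_injective (hK : IsQuasivariety K) (τ : Finset (L.Term Unit × L.Term Unit))
    {A : Type u} [L.Structure A] (h : Function.Injective (eqI τ : RelCongruence K A → Set A))
    (θ : RelCongruence K A) : eqXi hK τ (eqI τ θ) = θ :=
  h (eqI_eqXi_eqI hK τ θ)

/-- Every instance of `Ξ(S)` depends on finitely many elements of `S` only. -/
theorem exists_finite_eqXi (hK : IsQuasivariety K) (τ : Finset (L.Term Unit × L.Term Unit))
    {A : Type u} [L.Structure A] {S : Set A} {a b : A} (h : (eqXi hK τ S).1.r a b) :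
    ∃ D : Finset A, (D : Set A) ⊆ S ∧ (eqXi hK τ (D : Set A)).1.r a b := by
  classical
  let _ := relCongruenceLattice hK A
  have mono : ∀ {D E : Set A}, D ⊆ E → eqXi hK τ D ≤ eqXi hK τ E := fun {D E} hDE =>
    (eqXi_le_iff hK τ D _).2 (hDE.trans (subset_eqI_eqXi hK τ E))
  let G : Set (RelCongruence K A) :=
    (fun D : Finset A => eqXi hK τ (D : Set A)) '' {D | (D : Set A) ⊆ S}
  have hG : G.Nonempty := ⟨_, ∅, by simp, rfl⟩
  have hd : DirectedOn (· ≤ ·) G := by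
    rintro _ ⟨D, hD, rfl⟩ _ ⟨E, hE, rfl⟩
    refine ⟨_, ⟨D ∪ E, ?_, rfl⟩, mono ?_, mono ?_⟩
    · simpa using ⟨hD, hE⟩
    · simp
    · simp
  have hS : eqXi hK τ S ≤ sSup G := by
    refine (eqXi_le_iff hK τ S _).2 fun c hc => ?_
    have hle : eqXi hK τ (({c} : Finset A) : Set A) ≤ sSup G :=
      le_sSup ⟨{c}, by simpa using hc, rfl⟩
    exact (eqXi_le_iff hK τ _ _).1 hle (by simp)
  obtain ⟨_, ⟨D, hD, rfl⟩, hab⟩ := (relCongruence_sSup hK G hG hd a b).1 (hS a b h)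
  exact ⟨D, hD, hab⟩

/-! ### Theories and filters of the presented logic -/

theorem eqI_isTheory (hK : IsQuasivariety K) (τ : Finset (L.Term Unit × L.Term Unit)) {X : Type u}
    (θ : RelCongruence K (L.Term X)) : (eqLogic hK τ X).IsTheory (eqI τ θ) :=
  fun _ h => h θ subset_rfl

theorem eqI_eqXi_of_isTheory (hK : IsQuasivariety K) (τ : Finset (L.Term Unit × L.Term Unit))
    {X : Type u} {T : Set (L.Term X)} (hT : (eqLogic hK τ X).IsTheory T) :
    eqI τ (eqXi hK τ T) = T :=
  subset_antisymm
    (fun φ hφ => hT φ fun θ hθ => eqI_mono ((eqXi_le_iff hK τ T θ).2 hθ) hφ)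
    (subset_eqI_eqXi hK τ T)

theorem ConsequenceRelation.IsTheory.isFilter {X : Type*} {l : ConsequenceRelation L (L.Term X)}
    {T : Set (L.Term X)} (hT : l.IsTheory T) : l.IsFilter T :=
  fun Γ φ h w hw => hT _ (l.mono _ _ _ hw (l.structural Γ φ w h))

/-! ### Equivalence systems -/

/-- A finite set `D` of formulas in two variables is an equivalence system for `(Co_K, i)` if
`D(a, b) ⊆ i_A(θ)` is the same as `⟨a, b⟩ ∈ θ`, for all algebras `A` and all `θ ∈ Co_K(A)`. -/
def IsEquivalenceSystem (K : Set (CategoryTheory.Bundled.{u} L.Structure))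
    (τ : Finset (L.Term Unit × L.Term Unit)) (D : Finset (L.Term (Fin 2))) : Prop :=
  ∀ (A : Type u) [L.Structure A] (θ : RelCongruence K A) (a b : A),
    (∀ d ∈ D, d.realize ![a, b] ∈ eqI τ θ) ↔ θ.1.r a b

theorem exists_isEquivalenceSystem (hK : IsQuasivariety K)
    (τ : Finset (L.Term Unit × L.Term Unit)) (X : Type u) [Nontrivial X]
    (h : ∀ θ : RelCongruence K (L.Term X), eqXi hK τ (eqI τ θ) = θ) :
    ∃ D, IsEquivalenceSystem K τ D := by
  classical
  obtain ⟨x, y, hxy⟩ := exists_pair_ne X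
  let _ := relCongruenceLattice hK (L.Term X)
  -- `θ₀` is the least relative congruence that identifies the variables `x` and `y`.
  let θ₀ : RelCongruence K (L.Term X) :=
    sInf {θ | θ.1.r (FirstOrder.Language.Term.var x) (FirstOrder.Language.Term.var y)}
  have hθ₀ : θ₀.1.r (FirstOrder.Language.Term.var x) (FirstOrder.Language.Term.var y) :=
    (relCongruence_sInf hK _ _ _).2 fun θ hθ => hθ
  rw [← h θ₀] at hθ₀
  obtain ⟨D₀, hD₀, hxy₀⟩ := exists_finite_eqXi hK τ hθ₀
  let g : X → Fin 2 := fun z => if z = y then 1 else 0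
  refine ⟨D₀.image (FirstOrder.Language.Term.relabel g), fun A _ θ a b => ?_⟩
  let f : L.Term X →[L] A := evalHom fun z => ![a, b] (g z)
  have hfx : f (FirstOrder.Language.Term.var x) = a := by simp [f, g, hxy]
  have hfy : f (FirstOrder.Language.Term.var y) = b := by simp [f, g]
  have hD : (∀ d ∈ D₀.image (FirstOrder.Language.Term.relabel g), d.realize ![a, b] ∈ eqI τ θ) ↔
      (D₀ : Set (L.Term X)) ⊆ eqI τ (relComap hK f θ) := by
    rw [eqI_relComap, Finset.forall_mem_image]
    simp only [FirstOrder.Language.Term.realize_relabel]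
    rfl
  have hθ : θ.1.r a b ↔ (relComap hK f θ).1.r (FirstOrder.Language.Term.var x)
      (FirstOrder.Language.Term.var y) := by
    change _ ↔ θ.1.r (f _) (f _)
    rw [hfx, hfy]
  rw [hD, hθ]
  constructor
  · intro hsub
    exact (eqXi_le_iff hK τ _ _).2 hsub _ _ hxy₀
  · intro hr
    exact hD₀.trans (eqI_mono (sInf_le hr))

namespace IsEquivalenceSystem

variable {τ : Finset (L.Term Unit × L.Term Unit)} {D : Finset (L.Term (Fin 2))}

theorem eqXi_eqI (hD : IsEquivalenceSystem K τ D) (hK : IsQuasivariety K) {A : Type u}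
    [L.Structure A] (θ : RelCongruence K A) : eqXi hK τ (eqI τ θ) = θ := by
  refine (eqXi_eqI_le hK τ θ).antisymm fun a b hab => ?_
  rw [← hD A, eqI_eqXi_eqI, hD A]
  exact hab

theorem eq_leibniz_eqI (hD : IsEquivalenceSystem K τ D) {A : Type u} [L.Structure A]
    (θ : RelCongruence K A) : θ.1 = leibniz (eqI τ θ) := by
  refine (le_leibniz_eqI τ θ).antisymm fun a b hab => (hD A θ a b).1 fun d hd => ?_
  -- The Leibniz congruence relates `d(a, a)`, which lies in `i(θ)`, to `d(a, b)`.
  refine (leibniz_isGreatest (eqI τ θ)).1 _ _ ((hD A θ a a).2 (θ.1.iseqv.refl a) d hd)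
    ((leibniz (eqI τ θ)).realize_rel d _ _ fun j => ?_)
  fin_cases j
  · exact (leibniz _).iseqv.refl a
  · exact hab

theorem applyForms_subset_eqI (hD : IsEquivalenceSystem K τ D) {X : Type u}
    (Γ : Set (L.Term X × L.Term X)) (θ : RelCongruence K (L.Term X)) :
    applyForms (D : Set (L.Term (Fin 2))) Γ ⊆ eqI τ θ ↔ ∀ p ∈ Γ, θ.1.r p.1 p.2 := by
  constructor
  · intro h p hp
    exact (hD _ θ _ _).1 fun d hd => h ⟨d, hd, p, hp, rfl⟩
  · rintro h _ ⟨d, hd, p, hp, rfl⟩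
    exact (hD _ θ _ _).2 (h p hp) d hd

end IsEquivalenceSystem

theorem forall_applyEqs {A : Type u} [L.Structure A] (τ : Finset (L.Term Unit × L.Term Unit))
    (S : Set A) (θ : RelCongruence K A) :
    (∀ p ∈ applyEqs (τ : Set (L.Term Unit × L.Term Unit)) S, θ.1.r p.1 p.2) ↔ S ⊆ eqI τ θ := by
  constructor
  · intro h a ha e he
    exact h _ ⟨e, he, a, ha, rfl⟩
  · rintro h _ ⟨e, he, a, ha, rfl⟩
    exact h ha e he

namespace IsEquivalenceSystem

variable {τ : Finset (L.Term Unit × L.Term Unit)} {D : Finset (L.Term (Fin 2))}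

theorem entails_applyForms (hD : IsEquivalenceSystem K τ D) (hK : IsQuasivariety K) {X : Type u}
    (Γ : Set (L.Term X × L.Term X)) (e : L.Term X × L.Term X) :
    (∀ χ ∈ applyForms (D : Set (L.Term (Fin 2))) {e},
      (eqLogic hK τ X).entails (applyForms (D : Set (L.Term (Fin 2))) Γ) χ) ↔
    ∀ θ : RelCongruence K (L.Term X), (∀ p ∈ Γ, θ.1.r p.1 p.2) → θ.1.r e.1 e.2 := by
  simp only [eqLogic_entails, hD.applyForms_subset_eqI]
  constructor
  · intro h θ hθ
    have := (hD.applyForms_subset_eqI {e} θ).1 fun χ hχ => h χ hχ θ hθ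
    exact this e rfl
  · intro h χ hχ θ hθ
    refine (hD.applyForms_subset_eqI {e} θ).2 ?_ hχ
    rintro _ rfl
    exact h θ hθ

theorem applyForms_applyEqs_subset_eqI (hD : IsEquivalenceSystem K τ D) {X : Type u}
    (ψ : L.Term X) (θ : RelCongruence K (L.Term X)) :
    applyForms (D : Set (L.Term (Fin 2))) (applyEqs (τ : Set (L.Term Unit × L.Term Unit)) {ψ}) ⊆
      eqI τ θ ↔ ψ ∈ eqI τ θ :=
  ((hD.applyForms_subset_eqI _ θ).trans (forall_applyEqs τ _ θ)).trans Set.singleton_subset_iff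

theorem algebraizableWith (hD : IsEquivalenceSystem K τ D) (hK : IsQuasivariety K) (X : Type u) :
    AlgebraizableWith (eqLogic hK τ X) K := by
  refine ⟨τ, D, fun Γ φ => ?_, fun Γ e => ?_, fun ψ => ⟨fun χ hχ θ hθ => ?_, fun θ hθ => ?_⟩⟩
  · simp only [eqEntails_iff hK, forall_applyEqs, eqLogic_entails]
    constructor
    · intro h e he θ hθ
      exact (forall_applyEqs τ {φ} θ).2 (Set.singleton_subset_iff.2 (h θ hθ)) e he
    · intro h θ hθ
      exact (forall_applyEqs τ {φ} θ).1 (fun e he => h e he θ hθ) rfl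
  · rw [eqEntails_iff hK, hD.entails_applyForms hK]
  · exact (hD.applyForms_applyEqs_subset_eqI ψ θ).2 (hθ rfl) hχ
  · exact (hD.applyForms_applyEqs_subset_eqI ψ θ).1 hθ

/-- Valid implications between equations are respected by every filter, once the equations are
replaced by the formulas of an equivalence system. -/
theorem realize_mem_of_isFilter (hD : IsEquivalenceSystem K τ D) (hK : IsQuasivariety K)
    {X : Type u} {A : Type u} [L.Structure A] {F : Set A} (hF : (eqLogic hK τ X).IsFilter F)
    (Γ : Set (L.Term X × L.Term X)) (e : L.Term X × L.Term X)
    (h : ∀ θ : RelCongruence K (L.Term X), (∀ p ∈ Γ, θ.1.r p.1 p.2) → θ.1.r e.1 e.2) (w : X → A)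
    (hΓ : ∀ p ∈ Γ, ∀ d ∈ D, d.realize ![p.1.realize w, p.2.realize w] ∈ F) :
    ∀ d ∈ D, d.realize ![e.1.realize w, e.2.realize w] ∈ F := by
  have key : ∀ (d : L.Term (Fin 2)) (p : L.Term X × L.Term X),
      evalHom w (d.realize ![p.1, p.2]) = d.realize ![p.1.realize w, p.2.realize w] := by
    intro d p
    rw [hom_realize]
    congr 1
    funext j
    fin_cases j <;> rfl
  intro d hd
  rw [← key]
  refine hF _ _ ((hD.entails_applyForms hK Γ e).2 h _ ⟨d, hd, e, rfl, rfl⟩) (evalHom w) ?_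
  rintro _ ⟨_, ⟨d', hd', p, hp, rfl⟩, rfl⟩
  rw [key]
  exact hΓ p hp d' hd'

open FirstOrder.Language in
/-- The pairs `⟨a, b⟩` with `D(a, b) ⊆ F`, for a filter `F` and an equivalence system `D`, form a
congruence. -/
def congruenceOfFilter (hD : IsEquivalenceSystem K τ D) (hK : IsQuasivariety K) {X : Type u}
    [Infinite X] {A : Type u} [L.Structure A] {F : Set A} (hF : (eqLogic hK τ X).IsFilter F) :
    Congruence L A where
  r a b := ∀ d ∈ D, d.realize ![a, b] ∈ F
  iseqv := by
    let x : ℕ → X := Infinite.natEmbedding X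
    have hx : Function.Injective x := (Infinite.natEmbedding X).injective
    refine ⟨fun a => ?_, fun {a b} hab => ?_, fun {a b c} hab hbc => ?_⟩
    · exact hD.realize_mem_of_isFilter hK hF ∅ (Term.var (x 0), Term.var (x 0))
        (fun θ _ => θ.1.iseqv.refl _) (fun _ => a) (by simp)
    -- Symmetry and transitivity: `Function.extend x` assigns `a, b, c` to the variables involved,
    -- the values at all other variables are irrelevant.
    · have := hD.realize_mem_of_isFilter hK hF {(Term.var (x 0), Term.var (x 1))}
        (Term.var (x 1), Term.var (x 0)) (fun θ h => θ.1.iseqv.symm (h _ rfl))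
        (Function.extend x (fun n => if n = 0 then a else b) fun _ => a)
      simp [hx.extend_apply] at this
      exact this hab
    · have := hD.realize_mem_of_isFilter hK hF
        {(Term.var (x 0), Term.var (x 1)), (Term.var (x 1), Term.var (x 2))}
        (Term.var (x 0), Term.var (x 2))
        (fun θ h => θ.1.iseqv.trans (h (Term.var (x 0), Term.var (x 1)) (Or.inl rfl))
          (h (Term.var (x 1), Term.var (x 2)) (Or.inr rfl)))
        (Function.extend x (fun n => if n = 0 then a else if n = 1 then b else c) fun _ => a)
      simp [hx.extend_apply] at this
      exact this hab hbc
  map_fun' {n} f a b hab := by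
    -- The variables `x (inl j)` stand for the first arguments, `x (inr j)` for the second ones.
    obtain ⟨x⟩ : Nonempty ((Fin n ⊕ Fin n) ↪ X) :=
      ⟨(Function.Embedding.trans (Fintype.equivFin _).toEmbedding
        Fin.valEmbedding).trans (Infinite.natEmbedding X)⟩
    have ne : Nonempty A := ⟨Structure.funMap f a⟩
    have := hD.realize_mem_of_isFilter hK hF
      (Set.range fun j : Fin n => (Term.var (x (Sum.inl j)), Term.var (x (Sum.inr j))))
      (Term.func f fun j => Term.var (x (Sum.inl j)), Term.func f fun j => Term.var (x (Sum.inr j)))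
      (fun θ h => θ.1.map_fun' f _ _ fun j => h _ ⟨j, rfl⟩)
      (Function.extend x (Sum.elim a b) fun _ => ne.some)
    simp [x.injective.extend_apply] at this
    exact this hab

/-- Every filter of the logic is in the image of `i`. -/
theorem exists_eqI_eq (hD : IsEquivalenceSystem K τ D) (hK : IsQuasivariety K) {X : Type u}
    [Infinite X] {A : Type u} [L.Structure A] {F : Set A} (hF : (eqLogic hK τ X).IsFilter F) :
    ∃ θ : RelCongruence K A, eqI τ θ = F := by
  have hmem : (hD.congruenceOfFilter hK hF).quot ∈ K := by
    have hK' := hK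
    obtain ⟨Q, hQ⟩ := hK
    refine (hQ _).2 fun q hq => (q.holds_quot _).2 fun w hw => ?_
    -- Rename the variables of the quasi-identity and read it as an implication on `Fm(X)`.
    let x : ℕ ↪ X := Infinite.natEmbedding X
    let v : X → A := Function.extend x w fun _ => w 0
    let ι : L.Term ℕ → L.Term X := fun t => t.realize fun n => FirstOrder.Language.Term.var (x n)
    have hι : ∀ t, (ι t).realize v = t.realize w := by
      intro t
      have h := hom_realize (evalHom v) t fun n => FirstOrder.Language.Term.var (x n)
      simpa [v, x.injective.extend_apply] using h
    have h := hD.realize_mem_of_isFilter hK' hF ((fun e => (ι e.1, ι e.2)) '' q.premises)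
      (ι q.conclusion.1, ι q.conclusion.2)
      (fun θ hθ => (q.holds_quot _).1 ((hQ _).1 θ.2 q hq) _ fun e he => hθ _ ⟨e, he, rfl⟩) v
      (by
        rintro _ ⟨e, he, rfl⟩
        simp only [hι]
        exact hw e he)
    simp only [hι] at h
    exact h
  refine ⟨⟨_, hmem⟩, ?_⟩
  ext a
  -- A variable `ψ` is interderivable with `D(τ(ψ))`; evaluate it to `a`.
  let ψ : L.Term X := FirstOrder.Language.Term.var (Infinite.natEmbedding X 0)
  let f : L.Term X →[L] A := evalHom fun _ => a
  have hf : ∀ (d : L.Term (Fin 2)) (e : L.Term Unit × L.Term Unit),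
      f (d.realize ![e.1.realize fun _ => ψ, e.2.realize fun _ => ψ]) =
        d.realize ![e.1.realize fun _ => a, e.2.realize fun _ => a] := by
    intro d e
    rw [hom_realize]
    congr 1
    funext j
    fin_cases j <;> exact hom_realize f _ _
  constructor
  · intro ha
    refine hF _ ψ (fun θ hθ => (hD.applyForms_applyEqs_subset_eqI ψ θ).1 hθ) f ?_
    rintro _ ⟨_, ⟨d, hd, _, ⟨e, he, _, rfl, rfl⟩, rfl⟩, rfl⟩
    rw [hf]
    exact ha e he d hd
  · intro ha e he d hd
    change d.realize ![e.1.realize fun _ => a, e.2.realize fun _ => a] ∈ F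
    rw [← hf]
    refine hF {ψ} _ (fun θ hθ => (hD.applyForms_applyEqs_subset_eqI ψ θ).2 (hθ rfl) ?_) f ?_
    · exact ⟨d, hd, _, ⟨e, he, ψ, rfl, rfl⟩, rfl⟩
    · rintro _ ⟨_, rfl, rfl⟩
      exact ha

theorem eqXi_eq_leibniz (hD : IsEquivalenceSystem K τ D) (hK : IsQuasivariety K) {X : Type u}
    [Infinite X] {A : Type u} [L.Structure A] {F : Set A} (hF : (eqLogic hK τ X).IsFilter F) :
    (eqXi hK τ F).1 = leibniz F := by
  obtain ⟨θ, rfl⟩ := hD.exists_eqI_eq hK hF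
  rw [hD.eqXi_eqI hK]
  exact hD.eq_leibniz_eqI θ

end IsEquivalenceSystem

/-! ### The isomorphism with the lattice of theories -/

theorem isSubstitutionPreservingIso (hK : IsQuasivariety K)
    (τ : Finset (L.Term Unit × L.Term Unit)) (X : Type u)
    (h : ∀ θ : RelCongruence K (L.Term X), eqXi hK τ (eqI τ θ) = θ) :
    IsSubstitutionPreservingIso hK τ X := by
  refine ⟨{ toFun := fun θ => ⟨eqI τ θ, eqI_isTheory hK τ θ⟩
            invFun := fun T => eqXi hK τ T.1
            left_inv := h
            right_inv := fun T => Subtype.ext (eqI_eqXi_of_isTheory hK τ T.2)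
            map_rel_iff' := fun {θ ρ} => ?_ }, fun θ => rfl, fun σ θ => eqI_relComap hK τ σ θ⟩
  change eqI τ θ ⊆ eqI τ ρ ↔ θ ≤ ρ
  rw [← eqXi_le_iff hK, h]

theorem IsSubstitutionPreservingIso.eqXi_eqI {hK : IsQuasivariety K}
    {τ : Finset (L.Term Unit × L.Term Unit)} {X : Type u}
    (h : IsSubstitutionPreservingIso hK τ X) (θ : RelCongruence K (L.Term X)) :
    eqXi hK τ (eqI τ θ) = θ := by
  obtain ⟨Φ, hΦ, -⟩ := h
  refine eqXi_eqI_of_injective hK τ (fun ρ κ h => Φ.injective (Subtype.ext ?_)) θ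
  rw [hΦ, hΦ, h]

end AlgLogic

/-! ### Equivalence of the conditions -/

open AlgLogic

theorem theorem4p7 {L : FirstOrder.Language.{u, v}} [L.IsAlgebraic]
    (K : Set (CategoryTheory.Bundled.{u} L.Structure)) (hK : AlgLogic.IsQuasivariety K)
    (τ : Finset (L.Term Unit × L.Term Unit)) (X : Type u) [Countable X] [Infinite X] :
    (∀ (A : Type u) [L.Structure A] (θ : AlgLogic.RelCongruence K A),
      AlgLogic.eqXi hK τ (AlgLogic.eqI τ θ) ≤ θ ∧
        θ.1 ≤ AlgLogic.leibniz (AlgLogic.eqI τ θ)) ∧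
    List.TFAE [
      (∀ θ : AlgLogic.RelCongruence K (L.Term X),
          AlgLogic.eqXi hK τ (AlgLogic.eqI τ θ) = θ) ∨
        (∀ θ : AlgLogic.RelCongruence K (L.Term X),
          θ.1 = AlgLogic.leibniz (AlgLogic.eqI τ θ)),
      ∀ (A : Type u) [L.Structure A] (θ : AlgLogic.RelCongruence K A),
        AlgLogic.eqXi hK τ (AlgLogic.eqI τ θ) = θ ∧
          θ.1 = AlgLogic.leibniz (AlgLogic.eqI τ θ),
      ∀ (A : Type u) [L.Structure A] (F : Set A), (AlgLogic.eqLogic hK τ X).IsFilter F →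
        (AlgLogic.eqXi hK τ F).1 = AlgLogic.leibniz F,
      ∀ T : Set (L.Term X), (AlgLogic.eqLogic hK τ X).IsTheory T →
        (AlgLogic.eqXi hK τ T).1 = AlgLogic.leibniz T,
      AlgLogic.Algebraizable (AlgLogic.eqLogic hK τ X) ∧
        AlgLogic.IsSubstitutionPreservingIso hK τ X,
      AlgLogic.AlgebraizableWith (AlgLogic.eqLogic hK τ X) K ∧
        AlgLogic.IsSubstitutionPreservingIso hK τ X] := by
  refine ⟨fun A _ θ => ⟨eqXi_eqI_le hK τ θ, le_leibniz_eqI τ θ⟩, ?_⟩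
  have hsys : (∀ θ : RelCongruence K (L.Term X), eqXi hK τ (eqI τ θ) = θ) →
      ∃ D, IsEquivalenceSystem K τ D := exists_isEquivalenceSystem hK τ X
  have hinj : ((∀ θ : RelCongruence K (L.Term X), eqXi hK τ (eqI τ θ) = θ) ∨
      (∀ θ : RelCongruence K (L.Term X), θ.1 = leibniz (eqI τ θ))) →
      ∀ θ : RelCongruence K (L.Term X), eqXi hK τ (eqI τ θ) = θ := by
    rintro (h | h)
    · exact h
    · refine eqXi_eqI_of_injective hK τ fun θ ρ hθρ => Subtype.ext ?_
      rw [h θ, h ρ, hθρ]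
  tfae_have 1 → 2 := fun h A _ θ => by
    obtain ⟨D, hD⟩ := hsys (hinj h)
    exact ⟨hD.eqXi_eqI hK θ, hD.eq_leibniz_eqI θ⟩
  tfae_have 2 → 3 := fun h A _ F hF => by
    obtain ⟨D, hD⟩ := hsys fun θ => (h _ θ).1
    exact hD.eqXi_eq_leibniz hK hF
  tfae_have 3 → 4 := fun h T hT => h _ T hT.isFilter
  tfae_have 4 → 1 := fun h => Or.inl fun θ =>
    (eqXi_eqI_le hK τ θ).antisymm <| by
      change θ.1 ≤ (eqXi hK τ (eqI τ θ)).1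
      rw [h _ (eqI_isTheory hK τ θ)]
      exact le_leibniz_eqI τ θ
  tfae_have 1 → 6 := fun h => by
    obtain ⟨D, hD⟩ := hsys (hinj h)
    exact ⟨hD.algebraizableWith hK X, isSubstitutionPreservingIso hK τ X (hinj h)⟩
  tfae_have 6 → 5 := fun h => ⟨⟨K, h.1⟩, h.2⟩
  tfae_have 5 → 1 := fun h => Or.inl h.2.eqXi_eqI
  tfae_finish
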